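/- For $|p|<1$ write $(a;p)_\infty=\prod_{n\ge 0}(1-ap^n)$. For real $q>1$ let $$\Gamma_q(z)=\frac{(q^{-1};q^{-1})_\infty}{(q^{-z};q^{-1})_\infty}\,(q-1)^{1-z}\,q^{z(z-1)/2}$$ be the $q$-Gamma function (with $x^w=e^{w\ln x}$ for $x>0$), and let $\psi_q(z)=\dfrac{1}{\Gamma_q(z)}\dfrac{\partial\Gamma_q(z)}{\partial z}$ be the $q$-digamma function. Then $\Gamma_{e^\pi}$ is complex differentiable and non-zero at $\frac{1-i}{2}$ and at $\frac{1+i}{2}$, and $$\psi_{e^{\pi}}\left(\frac{1-i}{2}\right)-\psi_{e^{\pi}}\left(\frac{1+i}{2}\right)=-i\pi-\frac{i\,\Gamma\left(\frac14\right)^2}{4\sqrt{2\pi}}.$$ -/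

import Mathlib

/-- The infinite `q`-Pochhammer symbol `(a; p)_∞ = ∏_{n ≥ 0} (1 - a p ^ n)`, for `‖p‖ < 1`. -/
noncomputable def qPochhammerInf (a p : ℂ) : ℂ := ∏' n : ℕ, (1 - a * p ^ n)

/-- The `q`-analogue `Γ_q(z)` of the Gamma function, for a real base `q > 0`:
* for `0 < q < 1`, `Γ_q(z) = (q; q)_∞ / (q ^ z; q)_∞ * (1 - q) ^ (1 - z)`;
* for `q = 1`, `Γ_q(z) = Γ(z)`;
* for `q > 1`,
  `Γ_q(z) = (q⁻¹; q⁻¹)_∞ / (q ^ (-z); q⁻¹)_∞ * (q - 1) ^ (1 - z) * q ^ (z * (z - 1) / 2)`.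

All complex powers have a positive real base, so they are `x ^ w = exp (w * log x)`. -/
noncomputable def qGamma (q : ℝ) (z : ℂ) : ℂ :=
  if q < 1 then
    qPochhammerInf (q : ℂ) (q : ℂ) / qPochhammerInf ((q : ℂ) ^ z) (q : ℂ)
      * (1 - (q : ℂ)) ^ (1 - z)
  else if q = 1 then
    Complex.Gamma z
  else
    qPochhammerInf (q : ℂ)⁻¹ (q : ℂ)⁻¹ / qPochhammerInf ((q : ℂ) ^ (-z)) (q : ℂ)⁻¹
      * ((q : ℂ) - 1) ^ (1 - z) * (q : ℂ) ^ (z * (z - 1) / 2)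

/-- The `q`-digamma function `ψ_q(z) = (∂Γ_q(z)/∂z) / Γ_q(z)`, the logarithmic derivative of `Γ_q`
in the complex variable `z`. -/
noncomputable def qDigamma (q : ℝ) (z : ℂ) : ℂ := logDeriv (qGamma q) z

/-!
With `p = e ^ (-π)`, the logarithmic derivative of the product defining `Γ_q` is a Lambert series
(`qGamma_differentiableAt_and_logDeriv`). At `z = (1 ∓ i) / 2` the arguments `q ^ (-z)` are
`± i e ^ (-π / 2)`, and the difference of the two Lambert series collapses to
`i ∑_{n ≥ 0} sech (π (n + 1/2))`. What remains is the evaluation of this series, which is half the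
value `b` of `∑_{n ∈ ℤ} sech (π (n + 1/2))`.

Periodizing `sech` with period `2π` gives `F = sechSum (2π)`. The addition formulas for `sech` and
`tanh` make products of such series telescope along diagonals, which yields a first-order
differential system: `F' = F (X - 1)` and `X' = F (x + π) ^ 2 - F x ^ 2`, where `X` is a similar
series of differences of `tanh` (`hasDerivAt_sechSum`, `sechSum_sq`). Hence
`f = F x + F (x + π)`, `g = F x - F (x + π)` and `h = 1 - X` satisfy `g' = -h f`, `h' = f g`, and
`f ^ 2 - g ^ 2` is the constant `b ^ 2`. These are the equations of the Jacobi functions: if `φ` is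
the primitive of `f` with `φ 0 = 0` (`amplitude`, a series of Gudermannian functions, for which
`φ (π / 2) = π / 2` by telescoping), then `g = g 0 cos φ`.

The modulus is found from `g 0 = b`, which is Poisson summation for the function `sech (π x)`; that
this function is its own Fourier transform is the reflection formula for `Γ` written as a Beta
integral (`integral_exp_mul_sech`). So `φ' ^ 2 = b ^ 2 (1 + cos ^ 2 φ)` on `[0, π / 2]`, and the
substitution `x = cos ^ 4 φ` turns `B (1/4, 1/2)` into the integral of the constant `4 b` over an
interval of length `π / 2` (`betaIntegral_quarter_half`). Therefore `2 π b = B (1/4, 1/2)`, which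
the reflection formula expresses through `Γ (1/4)`.
-/

/-! ### Series over the integers -/

/-- A telescoping series over `ℤ`. -/
lemma tsum_int_sub_eq_of_tendsto {t : ℤ → ℝ} {l l' : ℝ}
    (hs : Summable fun k : ℤ => t (k + 1) - t k)
    (hl : Filter.Tendsto (fun n : ℕ => t n) Filter.atTop (nhds l))
    (hl' : Filter.Tendsto (fun n : ℕ => t (-n)) Filter.atTop (nhds l')) :
    ∑' k : ℤ, (t (k + 1) - t k) = l - l' := by
  have h1 := hs.hasSum.comp (Finset.tendsto_Ico_neg (R := ℤ))
  refine tendsto_nhds_unique h1 ((hl.sub hl').congr fun n => ?_)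
  induction n with
  | zero => simp
  | succ n ih =>
    have : Finset.Ico (-((n + 1 : ℕ) : ℤ)) ((n + 1 : ℕ) : ℤ)
        = insert (-(n : ℤ) - 1) (insert (n : ℤ) (Finset.Ico (-(n : ℤ)) n)) := by
      ext a; simp only [Finset.mem_Ico, Finset.mem_insert]; push_cast; omega
    simp only [Function.comp_apply] at ih ⊢
    rw [this, Finset.sum_insert, Finset.sum_insert, ← ih]
    · have e1 : -(n : ℤ) - 1 + 1 = -n := by ring
      have e2 : -((n + 1 : ℕ) : ℤ) = -(n : ℤ) - 1 := by push_cast; ring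
      rw [e1, e2]; push_cast; ring
    · simp
    · simp only [Finset.mem_Ico, Finset.mem_insert]; omega

/-- The product of two absolutely convergent series over `ℤ`, summed along the diagonals. -/
lemma hasSum_int_correlation {a b : ℤ → ℝ} (ha : Summable a) (hb : Summable b) :
    HasSum (fun k : ℤ => ∑' m : ℤ, a m * b (m + k)) ((∑' m, a m) * ∑' m, b m) := by
  have ha' : Summable fun m => ‖a m‖ := ha.norm
  have hb' : Summable fun m => ‖b m‖ := hb.norm
  have hs := summable_mul_of_summable_norm ha' hb'
  rw [tsum_mul_tsum_of_summable_norm ha' hb']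
  let e : ℤ × ℤ ≃ ℤ × ℤ :=
    { toFun := fun p => (p.2, p.2 + p.1)
      invFun := fun p => (p.2 - p.1, p.1)
      left_inv := fun p => by ext <;> simp
      right_inv := fun p => by ext <;> simp }
  have h2 : HasSum (fun p : ℤ × ℤ => a p.2 * b (p.2 + p.1))
      (∑' p : ℤ × ℤ, a p.1 * b p.2) := e.hasSum_iff.mpr hs.hasSum
  exact h2.prod_fiberwise fun k => (h2.summable.prod_factor k).hasSum

/-- Splitting a series over `ℤ` into its even and odd terms. -/
lemma tsum_int_even_add_odd {E : Type*} [NormedAddCommGroup E] [CompleteSpace E] {f : ℤ → E}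
    (hf : Summable f) :
    ∑' n, f n = ∑' m : ℤ, f (2 * m) + ∑' m : ℤ, f (2 * m + 1) := by
  have h2 : Function.Injective fun m : ℤ => 2 * m := fun a b h => by simpa using h
  have h3 : Function.Injective fun m : ℤ => 2 * m + 1 := fun a b h => by simpa using h
  have he := (h2.hasSum_range_iff (f := f)).mpr (hf.comp_injective h2).hasSum
  have ho := (h3.hasSum_range_iff (f := f)).mpr (hf.comp_injective h3).hasSum
  refine (he.add_isCompl ?_ ho).tsum_eq
  have : Set.range (fun m : ℤ => 2 * m + 1) = {n : ℤ | Odd n} := by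
    ext n; simp [Odd]
  have h' : Set.range (fun m : ℤ => 2 * m) = {n : ℤ | Even n} := by
    ext n; simp [even_iff_two_dvd, dvd_def]
  rw [this, h']
  simpa using Int.isCompl_even_odd

/-- A series over `ℤ` of a function odd about `c / 2` vanishes. -/
lemma tsum_int_eq_zero_of_odd {f : ℤ → ℝ} (c : ℤ) (h : ∀ k, f (c - k) = -f k) :
    ∑' k, f k = 0 := by
  have h1 := (Equiv.subLeft c).tsum_eq f
  simp only [Equiv.subLeft_apply, h, tsum_neg] at h1
  linarith

/-! ### Hyperbolic secant -/

/-- The hyperbolic secant. -/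
noncomputable def sech (x : ℝ) : ℝ := (Real.cosh x)⁻¹

lemma sech_pos (x : ℝ) : 0 < sech x := inv_pos.mpr (Real.cosh_pos x)

@[simp] lemma sech_neg (x : ℝ) : sech (-x) = sech x := by simp [sech]

lemma sech_le_one (x : ℝ) : sech x ≤ 1 := inv_le_one_of_one_le₀ (Real.one_le_cosh x)

lemma sech_le_exp (x : ℝ) : sech x ≤ 2 * Real.exp (-|x|) := by
  rw [sech, Real.exp_neg, ← Real.cosh_abs, Real.cosh_eq, ← div_eq_mul_inv, inv_div]
  exact div_le_div_of_nonneg_left zero_le_two (Real.exp_pos _)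
    (le_add_of_nonneg_right (Real.exp_pos _).le)

lemma hasDerivAt_tanh (x : ℝ) : HasDerivAt Real.tanh (sech x ^ 2) x := by
  have h := (Real.hasDerivAt_sinh x).div (Real.hasDerivAt_cosh x) (Real.cosh_pos x).ne'
  have e : Real.tanh = fun y => Real.sinh y / Real.cosh y := by
    ext y; exact Real.tanh_eq_sinh_div_cosh y
  rw [e]
  refine h.congr_deriv ?_
  have := Real.cosh_sq x
  rw [sech, inv_pow, div_eq_mul_inv]
  rw [show Real.cosh x * Real.cosh x - Real.sinh x * Real.sinh x = 1 by nlinarith, one_mul]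

lemma hasDerivAt_sech (x : ℝ) : HasDerivAt sech (-(sech x * Real.tanh x)) x := by
  refine ((Real.hasDerivAt_cosh x).inv (Real.cosh_pos x).ne').congr_deriv ?_
  have := (Real.cosh_pos x).ne'
  rw [sech, Real.tanh_eq_sinh_div_cosh]; field_simp

lemma continuous_sech : Continuous sech :=
  continuous_iff_continuousAt.mpr fun x => (hasDerivAt_sech x).continuousAt

/-- The Gudermannian function `arctan (sinh x)` is a primitive of `sech`. -/
lemma hasDerivAt_arctan_sinh (x : ℝ) :
    HasDerivAt (fun y => Real.arctan (Real.sinh y)) (sech x) x := by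
  refine (Real.hasDerivAt_sinh x).arctan.congr_deriv ?_
  have := (Real.cosh_pos x).ne'
  rw [sech, add_comm, ← Real.cosh_sq]; field_simp

lemma tanh_sub_tanh (x a : ℝ) :
    Real.tanh (x + a) - Real.tanh x = Real.sinh a * (sech x * sech (x + a)) := by
  have h1 := (Real.cosh_pos x).ne'
  have h2 := (Real.cosh_pos (x + a)).ne'
  have h3 : Real.sinh a = Real.sinh (x + a) * Real.cosh x - Real.cosh (x + a) * Real.sinh x := by
    rw [← Real.sinh_sub]; ring_nf
  rw [h3, sech, sech, Real.tanh_eq_sinh_div_cosh, Real.tanh_eq_sinh_div_cosh]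
  field_simp

lemma sech_mul_tanh_add {a : ℝ} (ha : a ≠ 0) (x : ℝ) :
    sech x * Real.tanh (x + a) =
      Real.cosh a / Real.sinh a * sech x - (Real.sinh a)⁻¹ * sech (x + a) := by
  have h1 := (Real.cosh_pos x).ne'
  have h2 := (Real.cosh_pos (x + a)).ne'
  have h0 : Real.sinh a ≠ 0 := by simpa using ha
  have h3 : Real.cosh x = Real.cosh (x + a) * Real.cosh a - Real.sinh (x + a) * Real.sinh a := by
    rw [← Real.cosh_sub]; ring_nf
  rw [sech, sech, Real.tanh_eq_sinh_div_cosh]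
  field_simp
  linarith

lemma tanh_eq_one_sub (x : ℝ) : Real.tanh x = 1 - 2 / (Real.exp (2 * x) + 1) := by
  rw [Real.tanh_eq, show 2 * x = x + x by ring, Real.exp_add, Real.exp_neg]
  have := Real.exp_pos x
  field_simp
  ring

lemma tendsto_tanh_atTop : Filter.Tendsto Real.tanh Filter.atTop (nhds 1) := by
  have e : Real.tanh = fun x => 1 - 2 / (Real.exp (2 * x) + 1) := funext tanh_eq_one_sub
  rw [e]
  have h : Filter.Tendsto (fun x : ℝ => Real.exp (2 * x) + 1) Filter.atTop Filter.atTop :=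
    Filter.tendsto_atTop_add_const_right _ _ (Real.tendsto_exp_atTop.comp
      (Filter.tendsto_id.const_mul_atTop two_pos))
  simpa using (h.const_div_atTop 2).const_sub 1

lemma tendsto_tanh_atBot : Filter.Tendsto Real.tanh Filter.atBot (nhds (-1)) := by
  have h := (tendsto_tanh_atTop.comp Filter.tendsto_neg_atBot_atTop).neg
  refine h.congr fun x => ?_
  simp

lemma tendsto_sinh_atTop : Filter.Tendsto Real.sinh Filter.atTop Filter.atTop :=
  Filter.tendsto_atTop_mono' _
    ((Filter.eventually_ge_atTop 0).mono fun _ h => Real.self_le_sinh_iff.mpr h) Filter.tendsto_id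

lemma tendsto_arctan_sinh_atTop :
    Filter.Tendsto (fun x => Real.arctan (Real.sinh x)) Filter.atTop (nhds (Real.pi / 2)) :=
  (Real.tendsto_arctan_atTop.mono_right nhdsWithin_le_nhds).comp tendsto_sinh_atTop

lemma tendsto_arctan_sinh_atBot :
    Filter.Tendsto (fun x => Real.arctan (Real.sinh x)) Filter.atBot (nhds (-(Real.pi / 2))) := by
  have h := (tendsto_arctan_sinh_atTop.comp Filter.tendsto_neg_atBot_atTop).neg
  refine h.congr fun x => ?_
  simp

lemma tendsto_add_natCast_mul_atTop {L : ℝ} (hL : 0 < L) (x : ℝ) :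
    Filter.Tendsto (fun n : ℕ => x + ((n : ℤ) : ℝ) * L) Filter.atTop Filter.atTop := by
  refine Filter.tendsto_atTop_add_const_left _ _ ?_
  simpa using tendsto_natCast_atTop_atTop.atTop_mul_const hL

lemma tendsto_add_neg_natCast_mul_atBot {L : ℝ} (hL : 0 < L) (x : ℝ) :
    Filter.Tendsto (fun n : ℕ => x + ((-(n : ℤ) : ℤ) : ℝ) * L) Filter.atTop Filter.atBot := by
  refine Filter.tendsto_atBot_add_const_left _ _ ?_
  have := Filter.tendsto_neg_atTop_atBot.comp
    ((tendsto_natCast_atTop_atTop (R := ℝ)).atTop_mul_const hL)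
  refine this.congr fun n => ?_
  simp

/-! ### Periodization of the hyperbolic secant -/

section Lattice

lemma summable_exp_neg_mul_abs_int {L : ℝ} (hL : 0 < L) :
    Summable fun m : ℤ => Real.exp (-(L * |(m : ℝ)|)) := by
  have h : Summable fun n : ℕ => Real.exp (-(L * |(((n : ℕ) : ℤ) : ℝ)|)) := by
    have := Real.summable_exp_nat_mul_iff.mpr (neg_lt_zero.mpr hL)
    refine this.congr fun n => ?_
    rw [Int.cast_natCast, abs_of_nonneg n.cast_nonneg]; ring_nf
  exact Summable.of_nat_of_neg h (by simpa using h)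

lemma sech_add_int_mul_le {L x R : ℝ} (hL : 0 < L) (hx : |x| ≤ R) (m : ℤ) :
    sech (x + m * L) ≤ 2 * Real.exp R * Real.exp (-(L * |(m : ℝ)|)) := by
  refine (sech_le_exp _).trans ?_
  rw [mul_assoc, ← Real.exp_add]
  gcongr
  have h1 : |(m : ℝ) * L| = L * |(m : ℝ)| := by rw [abs_mul, abs_of_pos hL, mul_comm]
  have h2 : |(m : ℝ) * L| ≤ |x + m * L| + |x| := by
    have := abs_sub (x + m * L) x
    rwa [add_sub_cancel_left] at this
  linarith

lemma summable_sech_add_int_mul {L : ℝ} (hL : 0 < L) (x : ℝ) :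
    Summable fun m : ℤ => sech (x + m * L) :=
  .of_nonneg_of_le (fun _ => (sech_pos _).le) (sech_add_int_mul_le hL le_rfl)
    ((summable_exp_neg_mul_abs_int hL).mul_left _)

/-- `∑ₘ (G (x + m L) - G (m L))`, the renormalized periodization of `G` with period `L`: the
subtracted constants make the series converge as soon as `G'` decays. -/
noncomputable def renormSum (L : ℝ) (G : ℝ → ℝ) (x : ℝ) : ℝ :=
  ∑' m : ℤ, (G (x + m * L) - G (m * L))

section renormSum

variable {L : ℝ} {G G' : ℝ → ℝ} (hL : 0 < L) (hG : ∀ x, HasDerivAt G (G' x) x)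
  (hG' : ∀ x, |G' x| ≤ sech x)

include hL hG hG'

lemma summable_and_hasDerivAt_renormSum (x : ℝ) : Summable (fun m : ℤ => G (x + m * L) - G (m * L)) ∧
    HasDerivAt (renormSum L G) (∑' m : ℤ, G' (x + m * L)) x := by
  have hu := (summable_exp_neg_mul_abs_int hL).mul_left (2 * Real.exp (|x| + 1))
  have hd : ∀ (m : ℤ) (y : ℝ), y ∈ Metric.ball (0 : ℝ) (|x| + 1) →
      HasDerivAt (fun y => G (y + m * L) - G (m * L)) (G' (y + m * L)) y := fun m y _ =>
    ((hG _).comp_add_const y (m * L)).sub_const _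
  have hb : ∀ (m : ℤ) (y : ℝ), y ∈ Metric.ball (0 : ℝ) (|x| + 1) →
      ‖G' (y + m * L)‖ ≤ 2 * Real.exp (|x| + 1) * Real.exp (-(L * |(m : ℝ)|)) := fun m y hy =>
    (hG' _).trans (sech_add_int_mul_le hL (by simpa using (mem_ball_zero_iff.mp hy).le) m)
  have h0 : (0 : ℝ) ∈ Metric.ball (0 : ℝ) (|x| + 1) := Metric.mem_ball_self (by positivity)
  have hx : x ∈ Metric.ball (0 : ℝ) (|x| + 1) := by simp
  have hs0 : Summable fun m : ℤ => G (0 + m * L) - G (m * L) := by simp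
  have hc := (convex_ball (0 : ℝ) (|x| + 1)).isPreconnected
  exact ⟨summable_of_summable_hasDerivAt_of_isPreconnected hu Metric.isOpen_ball hc hd hb h0 hs0 hx,
    hasDerivAt_tsum_of_isPreconnected hu Metric.isOpen_ball hc hd hb h0 hs0 hx⟩

lemma summable_renormSum (x : ℝ) : Summable fun m : ℤ => G (x + m * L) - G (m * L) :=
  (summable_and_hasDerivAt_renormSum hL hG hG' x).1

lemma hasDerivAt_renormSum (x : ℝ) :
    HasDerivAt (renormSum L G) (∑' m : ℤ, G' (x + m * L)) x :=
  (summable_and_hasDerivAt_renormSum hL hG hG' x).2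

lemma hasSum_renormSum_sub (x y : ℝ) :
    HasSum (fun m : ℤ => G (x + m * L) - G (y + m * L)) (renormSum L G x - renormSum L G y) := by
  have := (summable_renormSum hL hG hG' x).hasSum.sub (summable_renormSum hL hG hG' y).hasSum
  simpa only [sub_sub_sub_cancel_right, renormSum] using this

lemma renormSum_add_period {l : ℝ} (ht : Filter.Tendsto G Filter.atTop (nhds l))
    (hb : Filter.Tendsto G Filter.atBot (nhds (-l))) (x : ℝ) :
    renormSum L G (x + L) = renormSum L G x + 2 * l := by
  have h := hasSum_renormSum_sub hL hG hG' (x + L) x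
  have e : (fun m : ℤ => G (x + L + m * L) - G (x + m * L))
      = fun m : ℤ => G (x + ((m + 1 : ℤ) : ℝ) * L) - G (x + m * L) := by
    ext m; push_cast; ring_nf
  rw [e] at h
  have h1 := tsum_int_sub_eq_of_tendsto (t := fun m : ℤ => G (x + m * L)) h.summable
    (ht.comp (tendsto_add_natCast_mul_atTop hL x))
    (hb.comp (tendsto_add_neg_natCast_mul_atBot hL x))
  rw [h.tsum_eq] at h1
  linarith

end renormSum

lemma renormSum_neg {L : ℝ} {G : ℝ → ℝ} (hG : ∀ x, G (-x) = -G x) (x : ℝ) :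
    renormSum L G (-x) = -renormSum L G x := by
  have h := (Equiv.neg ℤ).tsum_eq fun m : ℤ => G (-x + m * L) - G (m * L)
  rw [renormSum, ← h, renormSum, ← tsum_neg]
  refine tsum_congr fun m => ?_
  have e1 : -x + ((Equiv.neg ℤ m : ℤ) : ℝ) * L = -(x + m * L) := by simp; ring
  have e2 : ((Equiv.neg ℤ m : ℤ) : ℝ) * L = -(m * L) := by simp
  rw [e1, e2, hG, hG]; ring

/-- The Jacobi-`dn`-type function `∑ₘ sech (x + m L)`. -/
noncomputable def sechSum (L x : ℝ) : ℝ := ∑' m : ℤ, sech (x + m * L)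

/-- The renormalized series `∑ₘ tanh (x + m L)`, a quasi-periodic zeta-type function. -/
noncomputable def tanhSum (L : ℝ) : ℝ → ℝ := renormSum L Real.tanh

/-- The renormalized series `∑ₘ arctan (sinh (x + m L))`, a primitive of `sechSum L`. -/
noncomputable def gdSum (L : ℝ) : ℝ → ℝ := renormSum L fun x => Real.arctan (Real.sinh x)

variable {L : ℝ} (hL : 0 < L)

lemma sechSum_neg (x : ℝ) : sechSum L (-x) = sechSum L x := by
  rw [sechSum, ← (Equiv.neg ℤ).tsum_eq, sechSum]
  refine tsum_congr fun m => ?_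
  rw [← sech_neg]
  congr 1
  simp
  ring

lemma sechSum_add_period (x : ℝ) : sechSum L (x + L) = sechSum L x := by
  rw [sechSum, sechSum, ← (Equiv.addRight (1 : ℤ)).tsum_eq (fun m : ℤ => sech (x + m * L))]
  refine tsum_congr fun m => ?_
  congr 1
  simp
  ring

lemma abs_sech_sq_le (x : ℝ) : |sech x ^ 2| ≤ sech x := by
  rw [abs_of_nonneg (sq_nonneg _)]
  have := sech_pos x
  nlinarith [sech_le_one x]

lemma abs_neg_sech_mul_tanh_le (x : ℝ) : |-(sech x * Real.tanh x)| ≤ sech x := by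
  rw [abs_neg, abs_mul, abs_of_pos (sech_pos x)]
  exact mul_le_of_le_one_right (sech_pos x).le (Real.abs_tanh_lt_one x).le

include hL

lemma sechSum_pos (x : ℝ) : 0 < sechSum L x :=
  (summable_sech_add_int_mul hL x).tsum_pos (fun _ => (sech_pos _).le) 0 (sech_pos _)

lemma sechSum_eq_renormSum (x : ℝ) : sechSum L x = renormSum L sech x + sechSum L 0 := by
  have h := (hasSum_renormSum_sub hL hasDerivAt_sech abs_neg_sech_mul_tanh_le x 0).tsum_eq
  have h0 : renormSum L sech 0 = 0 := by simp [renormSum]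
  rw [h0, sub_zero, (summable_sech_add_int_mul hL x).tsum_sub (summable_sech_add_int_mul hL 0)] at h
  rw [← h, sechSum, sechSum]; ring

lemma hasDerivAt_sechSum_tsum (x : ℝ) : HasDerivAt (sechSum L)
    (∑' m : ℤ, -(sech (x + m * L) * Real.tanh (x + m * L))) x := by
  rw [funext (sechSum_eq_renormSum hL)]
  exact (hasDerivAt_renormSum hL hasDerivAt_sech abs_neg_sech_mul_tanh_le x).add_const _

lemma hasDerivAt_gdSum (x : ℝ) : HasDerivAt (gdSum L) (sechSum L x) x :=
  hasDerivAt_renormSum hL hasDerivAt_arctan_sinh (fun x => (abs_of_pos (sech_pos x)).le) x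

lemma gdSum_add_period (x : ℝ) : gdSum L (x + L) = gdSum L x + Real.pi := by
  rw [gdSum, renormSum_add_period hL hasDerivAt_arctan_sinh (fun x => (abs_of_pos (sech_pos x)).le)
    tendsto_arctan_sinh_atTop tendsto_arctan_sinh_atBot]
  ring

lemma tanhSum_add_period (x : ℝ) : tanhSum L (x + L) = tanhSum L x + 2 := by
  rw [tanhSum, renormSum_add_period hL hasDerivAt_tanh abs_sech_sq_le
    tendsto_tanh_atTop tendsto_tanh_atBot]
  ring

lemma tanhSum_add_int_mul (x : ℝ) (k : ℤ) : tanhSum L (x + k * L) = tanhSum L x + 2 * k := by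
  induction k using Int.induction_on with
  | zero => simp
  | succ n ih =>
    have := tanhSum_add_period hL (x + (n : ℤ) * L)
    rw [ih] at this
    push_cast at this ⊢
    rw [show x + ((n : ℝ) + 1) * L = x + n * L + L by ring, this]; ring
  | pred n ih =>
    have := tanhSum_add_period hL (x + ((-(n : ℤ) - 1 : ℤ) : ℝ) * L)
    rw [show x + ((-(n : ℤ) - 1 : ℤ) : ℝ) * L + L = x + ((-(n : ℤ) : ℤ) : ℝ) * L by
      push_cast; ring, ih] at this
    push_cast at this ⊢
    linarith

omit hL in
lemma tanhSum_neg (x : ℝ) : tanhSum L (-x) = -tanhSum L x :=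
  renormSum_neg Real.tanh_neg x

omit hL in
lemma gdSum_neg (x : ℝ) : gdSum L (-x) = -gdSum L x :=
  renormSum_neg (fun x => by simp) x

lemma tanhSum_half_period : tanhSum L (L / 2) = 1 := by
  have h := tanhSum_add_period hL (-(L / 2))
  rw [tanhSum_neg, show -(L / 2) + L = L / 2 by ring] at h
  linarith

lemma gdSum_half_period : gdSum L (L / 2) = Real.pi / 2 := by
  have h := gdSum_add_period hL (-(L / 2))
  rw [gdSum_neg, show -(L / 2) + L = L / 2 by ring] at h
  linarith

/-- Along each nonzero diagonal `n - m = k` the products `sech (x + m L) sech (x + n L)` telescope,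
with a sum that does not depend on `x`; the diagonal `k = 0` contributes `∑ₘ sech (x + m L) ^ 2`. -/
lemma sechSum_sq : ∃ C : ℝ, ∀ x, sechSum L x ^ 2 = C + ∑' m : ℤ, sech (x + m * L) ^ 2 := by
  refine ⟨∑' k : ℤ, 2 * k / Real.sinh (k * L), fun x => ?_⟩
  have hS := summable_sech_add_int_mul hL x
  have h := hasSum_int_correlation hS hS
  -- The quotient at `k = 0` is `0 / 0 = 0`, so that the formula holds for every `k`.
  have hk : ∀ k : ℤ, ∑' m : ℤ, sech (x + m * L) * sech (x + (m + k : ℤ) * L)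
      - (if k = 0 then ∑' m : ℤ, sech (x + m * L) ^ 2 else 0) = 2 * k / Real.sinh (k * L) := by
    intro k
    rcases eq_or_ne k 0 with rfl | hk
    · simp [sq]
    · have hs : Real.sinh (k * L) ≠ 0 := by
        simpa using ⟨hk, hL.ne'⟩
      have h1 := (hasSum_renormSum_sub hL hasDerivAt_tanh abs_sech_sq_le (x + k * L) x).tsum_eq
      have h2 := tanhSum_add_int_mul hL x k
      rw [tanhSum] at h2
      rw [h2, add_sub_cancel_left] at h1
      rw [if_neg hk, sub_zero, ← h1, ← tsum_div_const]
      refine tsum_congr fun m => ?_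
      rw [show x + k * L + m * L = x + m * L + k * L by ring, tanh_sub_tanh,
        mul_div_cancel_left₀ _ hs]
      push_cast
      ring_nf
  have h3 := h.sub (hasSum_ite_eq (0 : ℤ) (∑' m : ℤ, sech (x + m * L) ^ 2))
  simp only [hk] at h3
  rw [h3.tsum_eq, sechSum]; ring

/-- A term at a zero of `sinh` counts as `0⁻¹ = 0`, which the hypothesis allows. -/
lemma summable_inv_sinh {x : ℝ} (c : ℝ) (hc : 0 < c)
    (hx : ∀ k : ℤ, x + k * L = 0 ∨ c ≤ |x + k * L|) :
    Summable fun k : ℤ => (Real.sinh (x + k * L))⁻¹ := by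
  refine .of_norm_bounded ((summable_sech_add_int_mul hL x).mul_left
    (Real.cosh c / Real.sinh c)) fun k => ?_
  have hs : 0 < Real.sinh c := Real.sinh_pos_iff.mpr hc
  rcases hx k with h | h
  · rw [h]
    simpa using mul_nonneg (div_nonneg (Real.cosh_pos c).le hs.le) (sech_pos 0).le
  · set y := x + k * L
    have h1 : 0 < Real.sinh |y| := Real.sinh_pos_iff.mpr (hc.trans_le h)
    have h2 : 0 ≤ Real.sinh (|y| - c) := Real.sinh_nonneg_iff.mpr (sub_nonneg.mpr h)
    rw [Real.sinh_sub] at h2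
    rw [norm_inv, Real.norm_eq_abs, Real.abs_sinh, sech, ← Real.cosh_abs y, ← div_eq_mul_inv,
      div_div, inv_eq_one_div, div_le_div_iff₀ h1 (mul_pos hs (Real.cosh_pos _))]
    linarith

omit hL in
lemma sechSum_add_int_mul (x : ℝ) (k : ℤ) : sechSum L (x + k * L) = sechSum L x := by
  have h : Function.Periodic (sechSum L) L := sechSum_add_period
  exact h.int_mul k x

lemma hasSum_sech_mul_tanh_add {a : ℝ} (ha : a ≠ 0) (x : ℝ) :
    HasSum (fun m : ℤ => sech (x + m * L) * Real.tanh (x + m * L + a))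
      (Real.cosh a / Real.sinh a * sechSum L x - (Real.sinh a)⁻¹ * sechSum L (x + a)) := by
  have h1 := (summable_sech_add_int_mul hL x).hasSum.mul_left (Real.cosh a / Real.sinh a)
  have h2 := (summable_sech_add_int_mul hL (x + a)).hasSum.mul_left (Real.sinh a)⁻¹
  refine (h1.sub h2).congr_fun fun m => ?_
  rw [sech_mul_tanh_add ha, show x + a + m * L = x + m * L + a by ring]

/-- The logarithmic derivative of `sechSum`. It comes from expanding the product of
`∑ₘ sech (x + m L)` and `∑ₙ (tanh (x + n L + L / 2) - tanh (x + n L))` along the diagonals by the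
addition formula `sech_mul_tanh_add`; the coefficients that appear are odd in the diagonal and
cancel, up to one constant, which is found at `x = 0`. -/
lemma hasDerivAt_sechSum (x : ℝ) : HasDerivAt (sechSum L)
    (sechSum L x * (tanhSum L (x + L / 2) - tanhSum L x - 1)) x := by
  have hc0 : Summable fun k : ℤ => (Real.sinh (k * L))⁻¹ := by
    have := summable_inv_sinh hL (x := 0) L hL fun k => by
      rcases eq_or_ne k 0 with rfl | hk
      · simp
      · right
        have : (1 : ℝ) ≤ |(k : ℝ)| := by exact_mod_cast Int.one_le_abs hk
        rw [zero_add, abs_mul, abs_of_pos hL]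
        nlinarith
    simpa using this
  have hne : ∀ k : ℤ, L / 2 ≤ |L / 2 + k * L| := fun k => by
    have h1 : (1 : ℝ) ≤ |((2 * k + 1 : ℤ) : ℝ)| := by
      exact_mod_cast Int.one_le_abs (by omega)
    rw [show L / 2 + k * L = ((2 * k + 1 : ℤ) : ℝ) * (L / 2) by push_cast; ring, abs_mul,
      abs_of_pos (half_pos hL)]
    nlinarith
  have hc1 : Summable fun k : ℤ => (Real.sinh (L / 2 + k * L))⁻¹ :=
    summable_inv_sinh hL (L / 2) (half_pos hL) fun k => Or.inr (hne k)
  have hne' : ∀ k : ℤ, L / 2 + k * L ≠ 0 := fun k h => by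
    have := hne k
    rw [h, abs_zero] at this
    linarith
  have z0 : ∑' k : ℤ, (Real.sinh (k * L))⁻¹ = 0 :=
    tsum_int_eq_zero_of_odd 0 fun k => by simp [Real.sinh_neg, inv_neg]
  have z1 : ∑' k : ℤ, (Real.sinh (L / 2 + k * L))⁻¹ = 0 :=
    tsum_int_eq_zero_of_odd (-1) fun k => by
      rw [← inv_neg, ← Real.sinh_neg]
      push_cast
      ring_nf
  -- The value `0` at the pole `k = 0` of the second quotient is the convention `1 / 0 = 0`.
  set α : ℤ → ℝ := fun k => Real.cosh (L / 2 + k * L) / Real.sinh (L / 2 + k * L)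
    - Real.cosh (k * L) / Real.sinh (k * L) with hα
  have key : ∀ x, HasSum (fun k => sechSum L x * α k)
      (sechSum L x * (tanhSum L (x + L / 2) - tanhSum L x)
        - ∑' m : ℤ, -(sech (x + m * L) * Real.tanh (x + m * L))) := by
    intro x
    have hS := summable_sech_add_int_mul hL x
    have hT := hasSum_renormSum_sub hL hasDerivAt_tanh abs_sech_sq_le (x + L / 2) x
    have h := hasSum_int_correlation hS hT.summable
    rw [hT.tsum_eq] at h
    have h1 := h.sub (hasSum_ite_eq (0 : ℤ)
      (∑' m : ℤ, -(sech (x + m * L) * Real.tanh (x + m * L))))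
    have h2 := (hc1.hasSum.mul_left (sechSum L (x + L / 2))).sub (hc0.hasSum.mul_left (sechSum L x))
    rw [z0, z1, mul_zero, mul_zero, sub_zero] at h2
    have h3 := h1.add h2
    rw [add_zero] at h3
    refine h3.congr_fun fun k => ?_
    have hd1 := hasSum_sech_mul_tanh_add hL (hne' k) x
    rw [← add_assoc, sechSum_add_int_mul] at hd1
    have hd0 : ∃ s, HasSum (fun m : ℤ => sech (x + m * L) * Real.tanh (x + m * L + k * L)) s ∧
        s = Real.cosh (k * L) / Real.sinh (k * L) * sechSum L x
          - (Real.sinh (k * L))⁻¹ * sechSum L x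
          - if k = 0 then ∑' m : ℤ, -(sech (x + m * L) * Real.tanh (x + m * L)) else 0 := by
      rcases eq_or_ne k 0 with rfl | hk
      · have : Summable fun m : ℤ => sech (x + m * L) * Real.tanh (x + m * L) := by
          refine .of_norm_bounded hS fun m => ?_
          rw [← norm_neg]
          exact abs_neg_sech_mul_tanh_le _
        exact ⟨_, by simpa using this.hasSum, by simp [tsum_neg]⟩
      · have := hasSum_sech_mul_tanh_add hL (a := k * L)
          (mul_ne_zero (Int.cast_ne_zero.mpr hk) hL.ne') x
        rw [sechSum_add_int_mul] at this
        exact ⟨_, this, by simp [hk]⟩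
    obtain ⟨s, hs, rfl⟩ := hd0
    have e : ∑' m : ℤ, sech (x + m * L) * (Real.tanh (x + L / 2 + (m + k : ℤ) * L)
        - Real.tanh (x + (m + k : ℤ) * L)) = _ := ((hd1.sub hs).congr_fun fun m => by
      rw [← mul_sub]; push_cast; ring_nf).tsum_eq
    rw [e, hα]
    ring
  have h0 : ∑' m : ℤ, -(sech (0 + m * L) * Real.tanh (0 + m * L)) = 0 :=
    tsum_int_eq_zero_of_odd 0 fun m => by simp
  have hF0 := (sechSum_pos hL 0).ne'
  have k0 := key 0
  rw [h0, zero_add, tanhSum_half_period hL, show tanhSum L 0 = 0 by simp [tanhSum, renormSum],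
    sub_zero, sub_zero, hasSum_mul_left_iff hF0] at k0
  have hx := (key x).unique (k0.mul_left (sechSum L x))
  refine (hasDerivAt_sechSum_tsum hL x).congr_deriv ?_
  linarith

end Lattice

/-! ### Self-duality of the hyperbolic secant under the Fourier transform -/

section Fourier

open Real in
lemma one_add_tanh_div_two (y : ℝ) : (1 + tanh y) / 2 = exp (y - log (2 * cosh y)) := by
  have := cosh_pos y
  rw [exp_sub, exp_log (by positivity), tanh_eq_sinh_div_cosh, ← cosh_add_sinh]
  field_simp

/-- `sech (π x)` is its own Fourier transform: the substitution `x = (1 + tanh (π y)) / 2` turns the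
Beta integral `B (1/2 + i k, 1/2 - i k) = π / cosh (π k)` into the Fourier integral. -/
lemma integral_exp_mul_sech (k : ℝ) :
    ∫ y : ℝ, Complex.exp (2 * Real.pi * k * y * Complex.I) * (sech (Real.pi * y) : ℂ)
      = sech (Real.pi * k) := by
  have hpi := Real.pi_pos
  set u : ℂ := 1 / 2 + k * Complex.I with hu
  set v : ℂ := 1 / 2 - k * Complex.I with hv
  have hur : u.re = 1 / 2 := by simp [hu]
  have hvr : v.re = 1 / 2 := by simp [hv]
  have huv : u + v = 1 := by rw [hu, hv]; ring
  have hB : Complex.betaIntegral u v = Real.pi * (sech (Real.pi * k) : ℂ) := by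
    have h := Complex.Gamma_mul_Gamma_eq_betaIntegral (s := u) (t := v)
      (by rw [hur]; norm_num) (by rw [hvr]; norm_num)
    rw [huv, Complex.Gamma_one, one_mul, ← sub_eq_of_eq_add' huv.symm,
      Complex.Gamma_mul_Gamma_one_sub] at h
    rw [← sub_eq_of_eq_add' huv.symm, ← h, sech, div_eq_mul_inv]
    have : Complex.sin (Real.pi * u) = Complex.cosh (Real.pi * k) := by
      rw [hu, show (Real.pi : ℂ) * (1 / 2 + k * Complex.I)
        = (Real.pi * k : ℂ) * Complex.I + Real.pi / 2 by ring, Complex.sin_add_pi_div_two,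
        Complex.cos_mul_I]
    rw [this]; push_cast; rfl
  have hder : ∀ y ∈ (Set.univ : Set ℝ), HasDerivWithinAt
      (fun y => (1 + Real.tanh (Real.pi * y)) / 2) (Real.pi / 2 * sech (Real.pi * y) ^ 2)
      Set.univ y := fun y _ => by
    have h := (hasDerivAt_tanh (Real.pi * y)).comp y ((hasDerivAt_id y).const_mul Real.pi)
    refine (((h.const_add 1).div_const 2).congr_deriv ?_).hasDerivWithinAt
    ring
  have hinj : Set.InjOn (fun y => (1 + Real.tanh (Real.pi * y)) / 2) Set.univ := fun a _ b _ h => by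
    have h1 : Real.tanh (Real.pi * a) = Real.tanh (Real.pi * b) := by
      have : (1 + Real.tanh (Real.pi * a)) / 2 = (1 + Real.tanh (Real.pi * b)) / 2 := h
      linarith
    exact mul_left_cancel₀ hpi.ne' (Real.tanh_injective h1)
  have himg : (fun y => (1 + Real.tanh (Real.pi * y)) / 2) '' Set.univ = Set.Ioo 0 1 := by
    ext x
    constructor
    · rintro ⟨y, -, rfl⟩
      have h1 := Real.tanh_lt_one (Real.pi * y)
      have h2 := Real.neg_one_lt_tanh (Real.pi * y)
      constructor <;> simp only <;> linarith
    · rintro ⟨h1, h2⟩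
      obtain ⟨z, -, hz⟩ := Real.tanh_surjOn (show 2 * x - 1 ∈ Set.Ioo (-1 : ℝ) 1 by
        constructor <;> linarith)
      refine ⟨z / Real.pi, trivial, ?_⟩
      simp only [mul_div_cancel₀ z hpi.ne', hz]
      ring
  have hcv := MeasureTheory.integral_image_eq_integral_abs_deriv_smul MeasurableSet.univ hder hinj
    (fun x : ℝ => (x : ℂ) ^ (u - 1) * (1 - x : ℂ) ^ (v - 1))
  rw [himg, ← MeasureTheory.integral_Ioc_eq_integral_Ioo,
    ← intervalIntegral.integral_of_le zero_le_one] at hcv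
  rw [Complex.betaIntegral, hcv, MeasureTheory.setIntegral_univ] at hB
  have hpiC : (Real.pi : ℂ) ≠ 0 := Complex.ofReal_ne_zero.mpr hpi.ne'
  apply mul_left_cancel₀ hpiC
  rw [← hB, ← MeasureTheory.integral_const_mul]
  refine MeasureTheory.integral_congr_ae (.of_forall fun y => ?_)
  have hc := Real.cosh_pos (Real.pi * y)
  have e1 := one_add_tanh_div_two (Real.pi * y)
  have e2 : 1 - (1 + Real.tanh (Real.pi * y)) / 2
      = Real.exp (-(Real.pi * y) - Real.log (2 * Real.cosh (Real.pi * y))) := by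
    rw [← Real.cosh_neg, ← one_add_tanh_div_two, Real.tanh_neg]; ring
  simp only []
  rw [show (1 - (((1 + Real.tanh (Real.pi * y)) / 2 : ℝ) : ℂ))
    = ((1 - (1 + Real.tanh (Real.pi * y)) / 2 : ℝ) : ℂ) by push_cast; ring, e2, e1]
  set l := Real.log (2 * Real.cosh (Real.pi * y)) with hl
  have hexp : ∀ (a : ℝ) (w : ℂ), ((Real.exp a : ℝ) : ℂ) ^ w = Complex.exp (a * w) := fun a w => by
    rw [Complex.cpow_def_of_ne_zero (Complex.ofReal_ne_zero.mpr (Real.exp_pos a).ne'),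
      ← Complex.ofReal_log (Real.exp_pos a).le, Real.log_exp]
  have hl' : Complex.exp l = 2 * Real.cosh (Real.pi * y) := by
    rw [← Complex.ofReal_exp, hl, Real.exp_log (by positivity)]; push_cast; ring
  rw [hexp, hexp, ← Complex.exp_add, abs_of_pos (by have := sech_pos (Real.pi * y); positivity),
    show ((Real.pi * y - l : ℝ) : ℂ) * (u - 1) + ((-(Real.pi * y) - l : ℝ) : ℂ) * (v - 1)
      = 2 * Real.pi * k * y * Complex.I + l by rw [hu, hv]; push_cast; ring,
    Complex.exp_add, hl', sech, Complex.real_smul]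
  have hcC : ((Real.cosh (Real.pi * y) : ℝ) : ℂ) ≠ 0 := Complex.ofReal_ne_zero.mpr hc.ne'
  push_cast at hcC ⊢
  field_simp

open FourierTransform in
lemma fourier_sech : 𝓕 (fun x : ℝ => (sech (Real.pi * x) : ℂ))
    = fun w : ℝ => (sech (Real.pi * w) : ℂ) := by
  ext w
  rw [Real.fourier_real_eq_integral_exp_smul, ← sech_neg, ← mul_neg, ← integral_exp_mul_sech]
  refine MeasureTheory.integral_congr_ae (.of_forall fun y => ?_)
  simp only [smul_eq_mul]
  congr 2
  push_cast
  ring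

/-- Poisson summation for the self-dual function `sech (π x)`, at the point `1 / 2`. -/
lemma tsum_sech_half_shift :
    ∑' n : ℤ, sech (Real.pi * (1 / 2 + n)) = ∑' n : ℤ, (-1 : ℝ) ^ n * sech (Real.pi * n) := by
  have hcont : Continuous fun x : ℝ => (sech (Real.pi * x) : ℂ) :=
    Complex.continuous_ofReal.comp (continuous_sech.comp (continuous_const.mul continuous_id))
  have hO : (fun x : ℝ => (sech (Real.pi * x) : ℂ)) =O[Filter.cocompact ℝ]
      fun x : ℝ => |x| ^ (-2 : ℝ) := by
    refine .of_bound 4 ?_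
    filter_upwards [(isCompact_singleton (x := (0 : ℝ))).compl_mem_cocompact] with x hx
    have hx0 : 0 < |x| := abs_pos.mpr hx
    have hy : |x| ≤ |Real.pi * x| := by
      rw [abs_mul, abs_of_pos Real.pi_pos]
      nlinarith [Real.pi_gt_three]
    have h1 := Real.quadratic_le_exp_of_nonneg (abs_nonneg (Real.pi * x))
    have h2 : |x| ^ 2 / 2 ≤ Real.exp |Real.pi * x| := by
      have := abs_nonneg (Real.pi * x)
      nlinarith
    have h3 := sech_le_exp (Real.pi * x)
    rw [Complex.norm_real, Real.norm_of_nonneg (sech_pos _).le, Real.norm_of_nonneg (by positivity),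
      Real.rpow_neg hx0.le, Real.rpow_two]
    refine h3.trans ?_
    rw [Real.exp_neg, ← div_eq_mul_inv, ← div_eq_mul_inv,
      div_le_div_iff₀ (Real.exp_pos _) (by positivity)]
    linarith
  have hsum : Summable fun n : ℤ => (sech (Real.pi * n) : ℂ) := by
    have := summable_sech_add_int_mul Real.pi_pos 0
    refine (Complex.summable_ofReal.mpr this).congr fun n => ?_
    rw [zero_add, mul_comm]
  have h := Real.tsum_eq_tsum_fourier_of_rpow_decay_of_summable hcont one_lt_two hO
    (by rw [fourier_sech]; exact hsum) (1 / 2)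
  rw [fourier_sech] at h
  apply Complex.ofReal_injective
  rw [Complex.ofReal_tsum, Complex.ofReal_tsum, h]
  refine tsum_congr fun n => ?_
  rw [fourier_coe_apply, show 2 * Real.pi * Complex.I * n * ((1 / 2 : ℝ) : ℂ) / (1 : ℝ)
    = n * (Real.pi * Complex.I) by push_cast; ring, Complex.exp_int_mul, Complex.exp_pi_mul_I]
  push_cast
  ring

lemma summable_sech_half_shift : Summable fun n : ℤ => sech (Real.pi * (1 / 2 + n)) :=
  (summable_sech_add_int_mul Real.pi_pos (Real.pi / 2)).congr fun n => by ring_nf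

lemma tsum_sech_half_shift_eq_sechSum :
    ∑' n : ℤ, sech (Real.pi * (1 / 2 + n)) = 2 * sechSum (2 * Real.pi) (Real.pi / 2) := by
  have e1 : ∑' m : ℤ, sech (Real.pi * (1 / 2 + (2 * m : ℤ))) = sechSum (2 * Real.pi) (Real.pi / 2) :=
    tsum_congr fun m => by push_cast; ring_nf
  have e2 : ∑' m : ℤ, sech (Real.pi * (1 / 2 + (2 * m + 1 : ℤ)))
      = sechSum (2 * Real.pi) (Real.pi / 2) := by
    rw [← sechSum_neg, ← sechSum_add_period]
    exact tsum_congr fun m => by push_cast; ring_nf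
  rw [tsum_int_even_add_odd summable_sech_half_shift, e1, e2]
  ring

/-- The modular relation `θ₂² = θ₄²` at the square lattice. -/
lemma sechSum_zero_sub_sechSum_pi :
    sechSum (2 * Real.pi) 0 - sechSum (2 * Real.pi) Real.pi
      = 2 * sechSum (2 * Real.pi) (Real.pi / 2) := by
  have hs : Summable fun n : ℤ => (-1 : ℝ) ^ n * sech (Real.pi * n) := by
    refine .of_norm_bounded (summable_sech_add_int_mul Real.pi_pos 0) fun n => ?_
    rw [norm_mul, norm_zpow, norm_neg, norm_one, one_zpow, one_mul,
      Real.norm_of_nonneg (sech_pos _).le, zero_add, mul_comm]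
  have e1 : ∑' m : ℤ, (-1 : ℝ) ^ (2 * m) * sech (Real.pi * (2 * m : ℤ))
      = sechSum (2 * Real.pi) 0 :=
    tsum_congr fun m => by rw [(even_two_mul m).neg_one_zpow]; push_cast; ring_nf
  have e2 : ∑' m : ℤ, (-1 : ℝ) ^ (2 * m + 1) * sech (Real.pi * (2 * m + 1 : ℤ))
      = -sechSum (2 * Real.pi) Real.pi := by
    rw [sechSum, ← tsum_neg]
    exact tsum_congr fun m => by rw [(odd_two_mul_add_one m).neg_one_zpow]; push_cast; ring_nf
  rw [← tsum_sech_half_shift_eq_sechSum, tsum_sech_half_shift, tsum_int_even_add_odd hs, e1, e2]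
  ring

/-- Reflecting `n` to `-1 - n` folds the series over `ℤ` onto the natural numbers. -/
lemma hasSum_nat_sech_half_shift :
    HasSum (fun n : ℕ => sech (Real.pi * (1 / 2 + n))) (sechSum (2 * Real.pi) (Real.pi / 2)) := by
  have hs : Summable fun n : ℕ => sech (Real.pi * (1 / 2 + n)) := by
    have := summable_sech_half_shift.comp_injective (Nat.cast_injective (R := ℤ))
    exact this.congr fun n => by simp
  have e : ∀ n : ℕ, sech (Real.pi * (1 / 2 + ((-((n : ℤ) + 1) : ℤ) : ℝ)))
      = sech (Real.pi * (1 / 2 + n)) := fun n => by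
    rw [← sech_neg]; push_cast; ring_nf
  have h := HasSum.of_nat_of_neg_add_one (f := fun n : ℤ => sech (Real.pi * (1 / 2 + n)))
    (by simpa using hs.hasSum) (by simpa only [e] using hs.hasSum)
  have := h.tsum_eq
  rw [tsum_sech_half_shift_eq_sechSum] at this
  rw [show sechSum (2 * Real.pi) (Real.pi / 2) = ∑' n : ℕ, sech (Real.pi * (1 / 2 + n)) by linarith]
  exact hs.hasSum

end Fourier

/-! ### The lemniscatic evaluation -/

section Lemniscate

/-- The amplitude: the primitive of `sechSum (2π) x + sechSum (2π) (x + π)` that vanishes at `0`. -/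
noncomputable def amplitude (x : ℝ) : ℝ :=
  gdSum (2 * Real.pi) x + gdSum (2 * Real.pi) (x + Real.pi) - Real.pi / 2

lemma hasDerivAt_amplitude (x : ℝ) : HasDerivAt amplitude
    (sechSum (2 * Real.pi) x + sechSum (2 * Real.pi) (x + Real.pi)) x := by
  have h := fun x => hasDerivAt_gdSum Real.two_pi_pos x
  exact ((h x).add ((h (x + Real.pi)).comp_add_const x Real.pi)).sub_const _

lemma strictMono_amplitude : StrictMono amplitude := by
  refine strictMono_of_deriv_pos fun x => ?_
  rw [(hasDerivAt_amplitude x).deriv]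
  exact add_pos (sechSum_pos Real.two_pi_pos _) (sechSum_pos Real.two_pi_pos _)

lemma gdSum_pi : gdSum (2 * Real.pi) Real.pi = Real.pi / 2 := by
  have := gdSum_half_period Real.two_pi_pos
  rwa [mul_div_cancel_left₀ _ two_ne_zero] at this

lemma amplitude_zero : amplitude 0 = 0 := by
  have h : gdSum (2 * Real.pi) 0 = 0 := by simp [gdSum, renormSum]
  rw [amplitude, zero_add, gdSum_pi, h]
  ring

lemma amplitude_pi_div_two : amplitude (Real.pi / 2) = Real.pi / 2 := by
  have h := gdSum_add_period Real.two_pi_pos (-(Real.pi / 2))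
  rw [gdSum_neg] at h
  rw [amplitude, show Real.pi / 2 + Real.pi = -(Real.pi / 2) + 2 * Real.pi by ring, h]
  ring

lemma hasDerivAt_sechSum_two_pi (x : ℝ) : HasDerivAt (sechSum (2 * Real.pi))
    (sechSum (2 * Real.pi) x *
      (tanhSum (2 * Real.pi) (x + Real.pi) - tanhSum (2 * Real.pi) x - 1)) x := by
  have := hasDerivAt_sechSum Real.two_pi_pos x
  rwa [mul_div_cancel_left₀ _ two_ne_zero] at this

lemma hasDerivAt_sechSum_two_pi_shift (x : ℝ) :
    HasDerivAt (fun x => sechSum (2 * Real.pi) (x + Real.pi))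
    (-(sechSum (2 * Real.pi) (x + Real.pi) *
      (tanhSum (2 * Real.pi) (x + Real.pi) - tanhSum (2 * Real.pi) x - 1))) x := by
  refine ((hasDerivAt_sechSum_two_pi (x + Real.pi)).comp_add_const x Real.pi).congr_deriv ?_
  rw [show x + Real.pi + Real.pi = x + 2 * Real.pi by ring, tanhSum_add_period Real.two_pi_pos]
  ring

lemma sechSum_three_pi_div_two :
    sechSum (2 * Real.pi) (Real.pi / 2 + Real.pi) = sechSum (2 * Real.pi) (Real.pi / 2) := by
  rw [show Real.pi / 2 + Real.pi = -(Real.pi / 2) + 2 * Real.pi by ring, sechSum_add_period,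
    sechSum_neg]

/-- The two half-period translates of `sechSum` have opposite logarithmic derivatives. -/
lemma sechSum_mul_sechSum_add_pi (x : ℝ) :
    sechSum (2 * Real.pi) x * sechSum (2 * Real.pi) (x + Real.pi)
      = sechSum (2 * Real.pi) (Real.pi / 2) ^ 2 := by
  have hd : ∀ x, HasDerivAt
      (fun x => sechSum (2 * Real.pi) x * sechSum (2 * Real.pi) (x + Real.pi)) 0 x := fun x =>
    ((hasDerivAt_sechSum_two_pi x).mul (hasDerivAt_sechSum_two_pi_shift x)).congr_deriv (by ring)
  have := is_const_of_deriv_eq_zero (fun x => (hd x).differentiableAt) (fun x => (hd x).deriv)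
    x (Real.pi / 2)
  simp only [sechSum_three_pi_div_two] at this
  rw [this, sq]

lemma hasDerivAt_tanhSum_sub (x : ℝ) :
    HasDerivAt (fun x => tanhSum (2 * Real.pi) (x + Real.pi) - tanhSum (2 * Real.pi) x)
      (sechSum (2 * Real.pi) (x + Real.pi) ^ 2 - sechSum (2 * Real.pi) x ^ 2) x := by
  obtain ⟨C, hC⟩ := sechSum_sq Real.two_pi_pos
  have h := fun x => hasDerivAt_renormSum Real.two_pi_pos hasDerivAt_tanh abs_sech_sq_le x
  refine (((h (x + Real.pi)).comp_add_const x Real.pi).sub (h x)).congr_deriv ?_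
  rw [hC, hC]
  ring

/-- The difference of the two translates, a Jacobi `cn` function, is proportional to the cosine of
the amplitude: together with the function `1 - (tanhSum (x + π) - tanhSum x)` it solves the
differential equations of a rotation by the angle `amplitude x`. -/
lemma sechSum_sub_sechSum_add_pi (x : ℝ) :
    sechSum (2 * Real.pi) x - sechSum (2 * Real.pi) (x + Real.pi)
      = 2 * sechSum (2 * Real.pi) (Real.pi / 2) * Real.cos (amplitude x) := by
  set g : ℝ → ℝ := fun x => sechSum (2 * Real.pi) x - sechSum (2 * Real.pi) (x + Real.pi) with hg
  set k : ℝ → ℝ := fun x => tanhSum (2 * Real.pi) (x + Real.pi) - tanhSum (2 * Real.pi) x with hk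
  have hg' : ∀ x, HasDerivAt g
      ((k x - 1) * (sechSum (2 * Real.pi) x + sechSum (2 * Real.pi) (x + Real.pi))) x := fun x =>
    ((hasDerivAt_sechSum_two_pi x).sub (hasDerivAt_sechSum_two_pi_shift x)).congr_deriv (by ring)
  have hk' := hasDerivAt_tanhSum_sub
  have hc := fun x => (hasDerivAt_amplitude x).cos
  have hs := fun x => (hasDerivAt_amplitude x).sin
  have hA : ∀ x, HasDerivAt (fun x => g x * Real.cos (amplitude x)
      + (1 - k x) * Real.sin (amplitude x)) 0 x := fun x =>
    (((hg' x).mul (hc x)).add (((hk' x).const_sub 1).mul (hs x))).congr_deriv (by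
      simp only [hg, hk]; ring)
  have hB : ∀ x, HasDerivAt (fun x => (1 - k x) * Real.cos (amplitude x)
      - g x * Real.sin (amplitude x)) 0 x := fun x =>
    ((((hk' x).const_sub 1).mul (hc x)).sub ((hg' x).mul (hs x))).congr_deriv (by
      simp only [hg, hk]; ring)
  have hA0 := is_const_of_deriv_eq_zero (fun x => (hA x).differentiableAt)
    (fun x => (hA x).deriv) x 0
  have hB0 := is_const_of_deriv_eq_zero (fun x => (hB x).differentiableAt)
    (fun x => (hB x).deriv) x 0
  have hg0 : g 0 = 2 * sechSum (2 * Real.pi) (Real.pi / 2) := by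
    rw [← sechSum_zero_sub_sechSum_pi]; simp [hg]
  have hk0 : k 0 = 1 := by
    have := tanhSum_half_period Real.two_pi_pos
    rw [mul_div_cancel_left₀ _ two_ne_zero] at this
    have h0 : tanhSum (2 * Real.pi) 0 = 0 := by simp [tanhSum, renormSum]
    simp [hk, this, h0]
  simp only [amplitude_zero, hg0, hk0, Real.cos_zero, Real.sin_zero] at hA0 hB0
  change g x = _
  linear_combination Real.cos (amplitude x) * hA0 - Real.sin (amplitude x) * hB0
    - g x * Real.cos_sq_add_sin_sq (amplitude x)

/-- The relation `dn² = cn² + const` between the sum and the difference of the two translates. -/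
lemma sechSum_add_sechSum_add_pi_sq (x : ℝ) :
    (sechSum (2 * Real.pi) x + sechSum (2 * Real.pi) (x + Real.pi)) ^ 2
      = (2 * sechSum (2 * Real.pi) (Real.pi / 2)) ^ 2 * (1 + Real.cos (amplitude x) ^ 2) := by
  have h1 := sechSum_mul_sechSum_add_pi x
  have h2 := sechSum_sub_sechSum_add_pi x
  linear_combination 4 * h1 + (sechSum (2 * Real.pi) x - sechSum (2 * Real.pi) (x + Real.pi)
    + 2 * sechSum (2 * Real.pi) (Real.pi / 2) * Real.cos (amplitude x)) * h2

/-- The substitution `x = cos (amplitude t) ^ 4` turns the integrand of `B (1/4, 1/2)` into a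
constant. -/
lemma betaIntegral_quarter_half : Complex.betaIntegral (1 / 4) (1 / 2)
    = ((4 * Real.pi * sechSum (2 * Real.pi) (Real.pi / 2) : ℝ) : ℂ) := by
  have hpi := Real.pi_pos
  set b := 2 * sechSum (2 * Real.pi) (Real.pi / 2) with hb
  have hb0 : 0 < b := mul_pos two_pos (sechSum_pos Real.two_pi_pos _)
  set f : ℝ → ℝ := fun x => sechSum (2 * Real.pi) x + sechSum (2 * Real.pi) (x + Real.pi) with hf
  have hf0 : ∀ x, 0 < f x := fun x =>
    add_pos (sechSum_pos Real.two_pi_pos _) (sechSum_pos Real.two_pi_pos _)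
  have hmem : ∀ t ∈ Set.Ioo 0 (Real.pi / 2), 0 < amplitude t ∧ amplitude t < Real.pi / 2 := by
    rintro t ⟨h1, h2⟩
    have h1' := strictMono_amplitude h1
    have h2' := strictMono_amplitude h2
    rw [amplitude_zero] at h1'
    rw [amplitude_pi_div_two] at h2'
    exact ⟨h1', h2'⟩
  have hcos : ∀ t ∈ Set.Ioo 0 (Real.pi / 2), 0 < Real.cos (amplitude t) := fun t ht =>
    Real.cos_pos_of_mem_Ioo ⟨by linarith [(hmem t ht).1], (hmem t ht).2⟩
  have hsin : ∀ t ∈ Set.Ioo 0 (Real.pi / 2), 0 < Real.sin (amplitude t) := fun t ht =>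
    Real.sin_pos_of_pos_of_lt_pi (hmem t ht).1 (by linarith [(hmem t ht).2])
  have hder : ∀ t, HasDerivAt (fun t => Real.cos (amplitude t) ^ 4)
      (-(4 * Real.cos (amplitude t) ^ 3 * Real.sin (amplitude t) * f t)) t := fun t =>
    ((hasDerivAt_amplitude t).cos.pow 4).congr_deriv (by simp only [hf]; push_cast; ring)
  have hinj : Set.InjOn (fun t => Real.cos (amplitude t) ^ 4) (Set.Ioo 0 (Real.pi / 2)) := by
    intro s hs t ht h
    have h1 := (pow_left_inj₀ (hcos s hs).le (hcos t ht).le four_ne_zero).mp h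
    refine strictMono_amplitude.injective (Real.injOn_cos ⟨(hmem s hs).1.le, ?_⟩
      ⟨(hmem t ht).1.le, ?_⟩ h1)
    · linarith [(hmem s hs).2]
    · linarith [(hmem t ht).2]
  have himg : (fun t => Real.cos (amplitude t) ^ 4) '' Set.Ioo 0 (Real.pi / 2) = Set.Ioo 0 1 := by
    apply Set.Subset.antisymm
    · rintro _ ⟨t, ht, rfl⟩
      have h1 := hcos t ht
      have h2 := hsin t ht
      have h3 : Real.cos (amplitude t) < 1 := by
        nlinarith [Real.cos_sq_add_sin_sq (amplitude t)]
      exact ⟨pow_pos h1 4, pow_lt_one₀ h1.le h3 four_ne_zero⟩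
    · have h := intermediate_value_Ioo' (f := fun t => Real.cos (amplitude t) ^ 4)
        (half_pos hpi).le (fun t _ => (hder t).continuousAt.continuousWithinAt)
      simpa [amplitude_zero, amplitude_pi_div_two] using h
  have hcv := MeasureTheory.integral_image_eq_integral_abs_deriv_smul measurableSet_Ioo
    (fun t _ => (hder t).hasDerivWithinAt) hinj
    (fun x : ℝ => (x : ℂ) ^ ((1 / 4 : ℂ) - 1) * (1 - x : ℂ) ^ ((1 / 2 : ℂ) - 1))
  rw [himg, ← MeasureTheory.integral_Ioc_eq_integral_Ioo,
    ← intervalIntegral.integral_of_le zero_le_one] at hcv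
  rw [Complex.betaIntegral, hcv, MeasureTheory.setIntegral_congr_fun (g := fun _ => ((4 * b : ℝ) : ℂ))
    measurableSet_Ioo, MeasureTheory.setIntegral_const]
  · rw [MeasureTheory.measureReal_def, Real.volume_Ioo, ENNReal.toReal_ofReal (by linarith),
      Complex.real_smul, ← Complex.ofReal_mul]
    congr 1
    rw [hb]; ring
  intro t ht
  have hc := hcos t ht
  have hs := hsin t ht
  have hft := hf0 t
  have hsq : f t ^ 2 = b ^ 2 * (1 + Real.cos (amplitude t) ^ 2) := sechSum_add_sechSum_add_pi_sq t
  set c := Real.cos (amplitude t)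
  set s := Real.sin (amplitude t)
  have hcs : c ^ 2 + s ^ 2 = 1 := Real.cos_sq_add_sin_sq _
  have h4 : 1 - c ^ 4 = (s * f t / b) ^ 2 := by
    rw [div_pow, mul_pow, hsq]
    field_simp
    linear_combination (-1 - c ^ 2) * hcs
  have e1 : (((c ^ 4 : ℝ)) : ℂ) ^ ((1 / 4 : ℂ) - 1) = (((c ^ 3)⁻¹ : ℝ) : ℂ) := by
    rw [show (1 / 4 : ℂ) - 1 = ((-3 / 4 : ℝ) : ℂ) by push_cast; norm_num,
      ← Complex.ofReal_cpow (by positivity), ← Real.rpow_natCast, ← Real.rpow_mul hc.le,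
      ← Real.rpow_natCast, ← Real.rpow_neg hc.le]
    norm_num
  have e2 : (1 - ((c ^ 4 : ℝ) : ℂ)) ^ ((1 / 2 : ℂ) - 1) = (((s * f t / b)⁻¹ : ℝ) : ℂ) := by
    have hp : 0 < s * f t / b := by positivity
    rw [show (1 / 2 : ℂ) - 1 = ((-1 / 2 : ℝ) : ℂ) by push_cast; norm_num,
      show (1 - ((c ^ 4 : ℝ) : ℂ)) = ((1 - c ^ 4 : ℝ) : ℂ) by push_cast; ring, h4,
      ← Complex.ofReal_cpow (by positivity), ← Real.rpow_natCast, ← Real.rpow_mul hp.le,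
      ← Real.rpow_neg_one]
    norm_num
  simp only []
  rw [e1, e2, abs_neg, abs_of_pos (by positivity), Complex.real_smul, ← Complex.ofReal_mul,
    ← Complex.ofReal_mul]
  congr 1
  field_simp
  rfl

lemma sechSum_pi_div_two : sechSum (2 * Real.pi) (Real.pi / 2)
    = Real.Gamma (1 / 4) ^ 2 / (4 * Real.pi * √(2 * Real.pi)) := by
  have h := Complex.Gamma_mul_Gamma_eq_betaIntegral (s := 1 / 4) (t := 1 / 2)
    (by norm_num) (by norm_num)
  rw [betaIntegral_quarter_half, show (1 / 4 : ℂ) = ((1 / 4 : ℝ) : ℂ) by push_cast; rfl,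
    show (1 / 2 : ℂ) = ((1 / 2 : ℝ) : ℂ) by push_cast; rfl, ← Complex.ofReal_add,
    Complex.Gamma_ofReal, Complex.Gamma_ofReal, Complex.Gamma_ofReal, ← Complex.ofReal_mul,
    ← Complex.ofReal_mul, Complex.ofReal_inj, Real.Gamma_one_half_eq] at h
  have h2 := Real.Gamma_mul_Gamma_one_sub (1 / 4)
  rw [show Real.pi * (1 / 4) = Real.pi / 4 by ring, Real.sin_pi_div_four,
    show (1 : ℝ) - 1 / 4 = 1 / 4 + 1 / 2 by norm_num] at h2
  have hpi := Real.pi_pos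
  have h3 : 0 < Real.Gamma (1 / 4 + 1 / 2) := Real.Gamma_pos_of_pos (by norm_num)
  have hr : √(2 * Real.pi) = √2 * √Real.pi := Real.sqrt_mul zero_le_two _
  have h5 : √Real.pi ^ 2 = Real.pi := Real.sq_sqrt hpi.le
  have h6 : √(2 : ℝ) ^ 2 = 2 := Real.sq_sqrt zero_le_two
  have h7 : 0 < √Real.pi := Real.sqrt_pos.mpr hpi
  have h8 : 0 < √(2 : ℝ) := Real.sqrt_pos.mpr two_pos
  rw [hr]
  set G := Real.Gamma (1 / 4)
  set G' := Real.Gamma (1 / 4 + 1 / 2)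
  set S := sechSum (2 * Real.pi) (Real.pi / 2)
  rw [eq_div_iff (by positivity)]
  have h2' : G * G' * √2 = 2 * Real.pi := by
    rw [h2]; field_simp
  apply mul_left_cancel₀ h3.ne'
  apply mul_left_cancel₀ h7.ne'
  linear_combination -√2 * √Real.pi ^ 2 * h - √Real.pi * G * √2 / 2 * h2'
    + √2 * √Real.pi * G * h5 + √Real.pi * G ^ 2 * G' / 2 * h6

end Lemniscate

/-! ### The logarithmic derivative of the `q`-Gamma function -/

section QGamma

variable {p : ℂ}

lemma multipliableLocallyUniformlyOn_one_sub_mul_pow (hp : ‖p‖ < 1) (R : ℝ) :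
    MultipliableLocallyUniformlyOn (fun (n : ℕ) (a : ℂ) => 1 - a * p ^ n) (Metric.ball 0 R) := by
  simp_rw [sub_eq_add_neg]
  refine Summable.multipliableLocallyUniformlyOn_nat_one_add Metric.isOpen_ball
    ((summable_geometric_of_lt_one (norm_nonneg p) hp).mul_left R) (.of_forall fun n a ha => ?_)
    fun n => by fun_prop
  rw [norm_neg, norm_mul, norm_pow]
  gcongr
  exact (mem_ball_zero_iff.mp ha).le

lemma differentiable_qPochhammerInf (hp : ‖p‖ < 1) :
    Differentiable ℂ fun a => qPochhammerInf a p := fun a =>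
  ((multipliableLocallyUniformlyOn_one_sub_mul_pow hp
      (‖a‖ + 1)).hasProdLocallyUniformlyOn.differentiableOn
    (.of_forall fun _ => by simpa [Finset.prod_fn] using
      DifferentiableOn.finsetProd (fun _ _ => by fun_prop)) Metric.isOpen_ball).differentiableAt
    (Metric.isOpen_ball.mem_nhds (by simp))

lemma summable_mul_pow (hp : ‖p‖ < 1) (a : ℂ) : Summable fun n : ℕ => a * p ^ n :=
  (summable_geometric_of_norm_lt_one hp).mul_left a

lemma qPochhammerInf_ne_zero (hp : ‖p‖ < 1) {a : ℂ} (ha : ∀ n : ℕ, 1 - a * p ^ n ≠ 0) :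
    qPochhammerInf a p ≠ 0 := by
  simp_rw [sub_eq_add_neg] at ha
  rw [qPochhammerInf]
  simp_rw [sub_eq_add_neg]
  exact tprod_one_add_ne_zero_of_summable ha (by simpa using (summable_mul_pow hp a).norm)

lemma summable_div_one_sub_mul_pow (hp : ‖p‖ < 1) (a : ℂ) :
    Summable fun n : ℕ => p ^ n / (1 - a * p ^ n) := by
  have ht : Filter.Tendsto (fun n : ℕ => 1 - a * p ^ n) Filter.atTop (nhds 1) := by
    simpa using (summable_mul_pow hp a).tendsto_atTop_zero.const_sub 1
  have hev : ∀ᶠ n : ℕ in Filter.atTop, 1 / 2 ≤ ‖1 - a * p ^ n‖ := by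
    have h := ht.norm
    rw [norm_one] at h
    exact h.eventually_const_le (by norm_num)
  refine .of_norm_bounded_eventually_nat
    ((summable_geometric_of_lt_one (norm_nonneg p) hp).mul_left 2) (hev.mono fun n hn => ?_)
  rw [norm_div, norm_pow, div_le_iff₀ (by linarith)]
  have := pow_nonneg (norm_nonneg p) n
  nlinarith

lemma logDeriv_qPochhammerInf (hp : ‖p‖ < 1) {a : ℂ} (ha : ∀ n : ℕ, 1 - a * p ^ n ≠ 0) :
    logDeriv (fun a => qPochhammerInf a p) a = -∑' n : ℕ, p ^ n / (1 - a * p ^ n) := by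
  have hd : ∀ n : ℕ, logDeriv (fun a : ℂ => 1 - a * p ^ n) a = -(p ^ n / (1 - a * p ^ n)) := by
    intro n
    have h : HasDerivAt (fun a : ℂ => 1 - a * p ^ n) (-(p ^ n)) a := by
      simpa using ((hasDerivAt_id a).mul_const (p ^ n)).const_sub 1
    rw [logDeriv_apply, h.deriv, neg_div]
  have h := logDeriv_tprod_eq_tsum (Metric.isOpen_ball (x := (0 : ℂ)) (ε := ‖a‖ + 1))
    (by simp : a ∈ Metric.ball (0 : ℂ) (‖a‖ + 1)) ha (fun n => by fun_prop)
    (by simpa only [hd] using (summable_div_one_sub_mul_pow hp a).neg)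
    (multipliableLocallyUniformlyOn_one_sub_mul_pow hp (‖a‖ + 1)) (qPochhammerInf_ne_zero hp ha)
  simp only [hd, tsum_neg] at h
  exact h

/-- For `q > 1`, away from the zeros of the denominator, `Γ_q` is differentiable and nonzero, and
its logarithmic derivative is a Lambert series. -/
lemma qGamma_differentiableAt_and_logDeriv {q : ℝ} (hq : 1 < q) {z : ℂ}
    (hz : ∀ n : ℕ, 1 - (q : ℂ) ^ (-z) * (q : ℂ)⁻¹ ^ n ≠ 0) :
    DifferentiableAt ℂ (qGamma q) z ∧ qGamma q z ≠ 0 ∧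
      qDigamma q z = -Real.log (q - 1) + (z - 1 / 2) * Real.log q
        - Real.log q * ∑' n : ℕ, (q : ℂ) ^ (-z) *
          ((q : ℂ)⁻¹ ^ n / (1 - (q : ℂ) ^ (-z) * (q : ℂ)⁻¹ ^ n)) := by
  have hq0 : 0 < q := zero_lt_one.trans hq
  have hqC : (q : ℂ) ≠ 0 := Complex.ofReal_ne_zero.mpr hq0.ne'
  have hq1C : (q : ℂ) - 1 ≠ 0 := by
    rw [← Complex.ofReal_one, ← Complex.ofReal_sub]
    exact Complex.ofReal_ne_zero.mpr (sub_pos.mpr hq).ne'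
  have hp : ‖(q : ℂ)⁻¹‖ < 1 := by
    rw [norm_inv, Complex.norm_real, Real.norm_of_nonneg hq0.le]
    exact inv_lt_one_of_one_lt₀ hq
  have hlog : Complex.log q = Real.log q := (Complex.ofReal_log hq0.le).symm
  have hlog1 : Complex.log ((q : ℂ) - 1) = Real.log (q - 1) := by
    rw [Complex.ofReal_log (sub_pos.mpr hq).le]; push_cast; rfl
  have hfun : qGamma q = fun z => qPochhammerInf (q : ℂ)⁻¹ (q : ℂ)⁻¹
      / qPochhammerInf ((q : ℂ) ^ (-z)) (q : ℂ)⁻¹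
      * ((q : ℂ) - 1) ^ (1 - z) * (q : ℂ) ^ (z * (z - 1) / 2) := by
    ext z
    rw [qGamma, if_neg hq.not_gt, if_neg hq.ne']
  have hc : qPochhammerInf (q : ℂ)⁻¹ (q : ℂ)⁻¹ ≠ 0 := by
    refine qPochhammerInf_ne_zero hp fun n h => ?_
    rw [← pow_succ', sub_eq_zero] at h
    have h1 : ‖(q : ℂ)⁻¹ ^ (n + 1)‖ < 1 := by
      rw [norm_pow]; exact pow_lt_one₀ (norm_nonneg _) hp n.succ_ne_zero
    rw [← h, norm_one] at h1
    exact lt_irrefl _ h1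
  have hP := qPochhammerInf_ne_zero hp hz
  have ha : HasDerivAt (fun z : ℂ => (q : ℂ) ^ (-z)) (-((q : ℂ) ^ (-z) * Real.log q)) z := by
    refine ((hasDerivAt_id z).neg.const_cpow (Or.inl hqC)).congr_deriv ?_
    rw [hlog]; simp
  have hA : DifferentiableAt ℂ (fun z => qPochhammerInf ((q : ℂ) ^ (-z)) (q : ℂ)⁻¹) z :=
    (differentiable_qPochhammerInf hp _).comp z ha.differentiableAt
  have hB : HasDerivAt (fun z : ℂ => ((q : ℂ) - 1) ^ (1 - z))
      (-(((q : ℂ) - 1) ^ (1 - z) * Real.log (q - 1))) z := by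
    refine (((hasDerivAt_id z).const_sub 1).const_cpow (Or.inl hq1C)).congr_deriv ?_
    rw [hlog1]; simp
  have hC : HasDerivAt (fun z : ℂ => (q : ℂ) ^ (z * (z - 1) / 2))
      ((q : ℂ) ^ (z * (z - 1) / 2) * Real.log q * (z - 1 / 2)) z := by
    refine ((((hasDerivAt_id z).mul ((hasDerivAt_id z).sub_const 1)).div_const 2).const_cpow
      (Or.inl hqC)).congr_deriv ?_
    rw [hlog]; simp only [id, Pi.mul_apply]; ring
  have hB0 : ((q : ℂ) - 1) ^ (1 - z) ≠ 0 := by simp [Complex.cpow_eq_zero_iff, hq1C]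
  have hC0 : (q : ℂ) ^ (z * (z - 1) / 2) ≠ 0 := by simp [Complex.cpow_eq_zero_iff, hqC]
  have hD : DifferentiableAt ℂ (fun z => qPochhammerInf (q : ℂ)⁻¹ (q : ℂ)⁻¹
      / qPochhammerInf ((q : ℂ) ^ (-z)) (q : ℂ)⁻¹) z := (differentiableAt_const _).div hA hP
  refine ⟨?_, ?_, ?_⟩
  · rw [hfun]
    exact (hD.mul hB.differentiableAt).mul hC.differentiableAt
  · rw [hfun]
    exact mul_ne_zero (mul_ne_zero (div_ne_zero hc hP) hB0) hC0
  · have hcomp := logDeriv_comp (f := fun a => qPochhammerInf a (q : ℂ)⁻¹)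
      (g := fun z : ℂ => (q : ℂ) ^ (-z)) (x := z)
      (differentiable_qPochhammerInf hp _) ha.differentiableAt
    rw [logDeriv_qPochhammerInf hp hz, ha.deriv] at hcomp
    have hcomp' : logDeriv (fun z : ℂ => qPochhammerInf ((q : ℂ) ^ (-z)) (q : ℂ)⁻¹) z = _ := hcomp
    have h2 := logDeriv_mul (f := fun z => qPochhammerInf (q : ℂ)⁻¹ (q : ℂ)⁻¹
      / qPochhammerInf ((q : ℂ) ^ (-z)) (q : ℂ)⁻¹) (g := fun z => ((q : ℂ) - 1) ^ (1 - z)) z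
      (div_ne_zero hc hP) hB0 hD hB.differentiableAt
    have h1 := logDeriv_mul (f := fun z => qPochhammerInf (q : ℂ)⁻¹ (q : ℂ)⁻¹
      / qPochhammerInf ((q : ℂ) ^ (-z)) (q : ℂ)⁻¹ * ((q : ℂ) - 1) ^ (1 - z))
      (g := fun z => (q : ℂ) ^ (z * (z - 1) / 2)) z
      (mul_ne_zero (div_ne_zero hc hP) hB0) hC0 (hD.fun_mul hB.differentiableAt) hC.differentiableAt
    have h3 := logDeriv_div (f := fun _ => qPochhammerInf (q : ℂ)⁻¹ (q : ℂ)⁻¹)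
      (g := fun z => qPochhammerInf ((q : ℂ) ^ (-z)) (q : ℂ)⁻¹) z
      hc hP (differentiableAt_const _) hA
    rw [qDigamma, hfun, h1, h2, h3, hcomp', logDeriv_const,
      logDeriv_apply, logDeriv_apply, hB.deriv, hC.deriv, tsum_mul_left, neg_div,
      mul_div_cancel_left₀ _ hB0, mul_assoc, mul_div_cancel_left₀ _ hC0, Pi.zero_apply]
    ring

lemma one_sub_I_mul_ne_zero (r : ℝ) : 1 - Complex.I * r ≠ 0 := fun h => by
  simpa using congrArg Complex.re h

lemma one_add_I_mul_ne_zero (r : ℝ) : 1 + Complex.I * r ≠ 0 := fun h => by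
  simpa using congrArg Complex.re h

lemma I_mul_div_add_I_mul_div (t : ℝ) :
    Complex.I * (Real.exp (-t) / (1 - Complex.I * Real.exp (-t)))
      + Complex.I * (Real.exp (-t) / (1 + Complex.I * Real.exp (-t)))
      = Complex.I * (sech t : ℂ) := by
  have h1 := one_sub_I_mul_ne_zero (Real.exp (-t))
  have h2 := one_add_I_mul_ne_zero (Real.exp (-t))
  have h3 : sech t = 2 * Real.exp (-t) / (1 + Real.exp (-t) ^ 2) := by
    rw [sech, Real.cosh_eq, Real.exp_neg]
    have := Real.exp_pos t
    field_simp
  have h4 : (1 - Complex.I * Real.exp (-t)) * (1 + Complex.I * Real.exp (-t))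
      = 1 + (Real.exp (-t) : ℂ) ^ 2 := by
    linear_combination -(Real.exp (-t) : ℂ) ^ 2 * Complex.I_sq
  have h5 : (1 : ℂ) + (Real.exp (-t) : ℂ) ^ 2 ≠ 0 := h4 ▸ mul_ne_zero h1 h2
  rw [h3, Complex.ofReal_div, Complex.ofReal_add, Complex.ofReal_mul, Complex.ofReal_pow,
    Complex.ofReal_one, Complex.ofReal_ofNat, ← h4]
  field_simp
  ring

end QGamma

theorem mainTheorem9 :
    (∀ z : ℂ, z = (1 - Complex.I) / 2 ∨ z = (1 + Complex.I) / 2 →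
      DifferentiableAt ℂ (qGamma (Real.exp Real.pi)) z ∧ qGamma (Real.exp Real.pi) z ≠ 0) ∧
    qDigamma (Real.exp Real.pi) ((1 - Complex.I) / 2)
        - qDigamma (Real.exp Real.pi) ((1 + Complex.I) / 2)
      = -Complex.I * (Real.pi : ℂ)
        - Complex.I * (Real.Gamma (1 / 4) : ℂ) ^ 2 / (4 * (Real.sqrt (2 * Real.pi) : ℂ)) := by
  have hq : 1 < Real.exp Real.pi := Real.one_lt_exp_iff.mpr Real.pi_pos
  have hcpow : ∀ w : ℂ, (Real.exp Real.pi : ℂ) ^ w = Complex.exp (Real.pi * w) := fun w => by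
    rw [Complex.cpow_def_of_ne_zero (Complex.ofReal_ne_zero.mpr (Real.exp_pos _).ne'),
      ← Complex.ofReal_log (Real.exp_pos _).le, Real.log_exp]
  -- The arguments `q ^ (-z)` of the `q`-Pochhammer symbol are `± I * exp (-π / 2)`.
  have hpow : ∀ n : ℕ, Complex.exp (-(Real.pi / 2)) * (Real.exp Real.pi : ℂ)⁻¹ ^ n
      = (Real.exp (-(Real.pi * (1 / 2 + n))) : ℂ) := fun n => by
    rw [Complex.ofReal_exp, Complex.ofReal_exp, ← Complex.exp_neg, ← Complex.exp_nat_mul,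
      ← Complex.exp_add]
    congr 1
    push_cast
    ring
  have ha1 : (Real.exp Real.pi : ℂ) ^ (-((1 - Complex.I) / 2))
      = Complex.I * Complex.exp (-(Real.pi / 2)) := by
    rw [hcpow, show (Real.pi : ℂ) * -((1 - Complex.I) / 2)
      = Real.pi / 2 * Complex.I + -(Real.pi / 2) by ring, Complex.exp_add,
      Complex.exp_pi_div_two_mul_I]
  have ha2 : (Real.exp Real.pi : ℂ) ^ (-((1 + Complex.I) / 2))
      = -Complex.I * Complex.exp (-(Real.pi / 2)) := by
    rw [hcpow, show (Real.pi : ℂ) * -((1 + Complex.I) / 2)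
      = -(Real.pi / 2 * Complex.I) + -(Real.pi / 2) by ring, Complex.exp_add, Complex.exp_neg,
      Complex.exp_pi_div_two_mul_I, Complex.inv_I]
  have hz1 : ∀ n : ℕ, 1 - (Real.exp Real.pi : ℂ) ^ (-((1 - Complex.I) / 2))
      * (Real.exp Real.pi : ℂ)⁻¹ ^ n ≠ 0 := fun n => by
    rw [ha1, mul_assoc, hpow]
    exact one_sub_I_mul_ne_zero _
  have hz2 : ∀ n : ℕ, 1 - (Real.exp Real.pi : ℂ) ^ (-((1 + Complex.I) / 2))
      * (Real.exp Real.pi : ℂ)⁻¹ ^ n ≠ 0 := fun n => by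
    rw [ha2, mul_assoc, hpow, neg_mul, sub_neg_eq_add]
    exact one_add_I_mul_ne_zero _
  obtain ⟨hd1, hn1, hψ1⟩ := qGamma_differentiableAt_and_logDeriv hq hz1
  obtain ⟨hd2, hn2, hψ2⟩ := qGamma_differentiableAt_and_logDeriv hq hz2
  refine ⟨?_, ?_⟩
  · rintro z (rfl | rfl)
    exacts [⟨hd1, hn1⟩, ⟨hd2, hn2⟩]
  have hp : ‖(Real.exp Real.pi : ℂ)⁻¹‖ < 1 := by
    rw [norm_inv, Complex.norm_real, Real.norm_of_nonneg (Real.exp_pos _).le]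
    exact inv_lt_one_of_one_lt₀ hq
  have hs : ∀ a : ℂ, Summable fun n : ℕ => a * ((Real.exp Real.pi : ℂ)⁻¹ ^ n
      / (1 - a * (Real.exp Real.pi : ℂ)⁻¹ ^ n)) := fun a =>
    (summable_div_one_sub_mul_pow hp a).mul_left a
  have hsum := (Complex.hasSum_ofReal.mpr hasSum_nat_sech_half_shift).mul_left Complex.I
  have hdiff := (hs (Complex.I * Complex.exp (-(Real.pi / 2)))).tsum_sub
    (hs (-Complex.I * Complex.exp (-(Real.pi / 2))))
  have hterm : ∀ n : ℕ, Complex.I * Complex.exp (-(Real.pi / 2)) * ((Real.exp Real.pi : ℂ)⁻¹ ^ n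
        / (1 - Complex.I * Complex.exp (-(Real.pi / 2)) * (Real.exp Real.pi : ℂ)⁻¹ ^ n))
      - -Complex.I * Complex.exp (-(Real.pi / 2)) * ((Real.exp Real.pi : ℂ)⁻¹ ^ n
        / (1 - -Complex.I * Complex.exp (-(Real.pi / 2)) * (Real.exp Real.pi : ℂ)⁻¹ ^ n))
      = Complex.I * (sech (Real.pi * (1 / 2 + n)) : ℂ) := fun n => by
    rw [← I_mul_div_add_I_mul_div, ← hpow]
    simp only [mul_assoc, neg_mul, sub_neg_eq_add, mul_div_assoc]
  simp only [hterm] at hdiff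
  rw [hsum.tsum_eq, sechSum_pi_div_two] at hdiff
  rw [hψ1, hψ2, Real.log_exp, ha1, ha2]
  have hfin : (Real.pi : ℂ) * (Complex.I * ((Real.Gamma (1 / 4) ^ 2
      / (4 * Real.pi * √(2 * Real.pi)) : ℝ) : ℂ))
      = Complex.I * (Real.Gamma (1 / 4) : ℂ) ^ 2 / (4 * (√(2 * Real.pi) : ℂ)) := by
    have h1 : (Real.pi : ℂ) ≠ 0 := Complex.ofReal_ne_zero.mpr Real.pi_ne_zero
    have h2 : (√(2 * Real.pi) : ℂ) ≠ 0 :=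
      Complex.ofReal_ne_zero.mpr (Real.sqrt_pos.mpr Real.two_pi_pos).ne'
    rw [Complex.ofReal_div, Complex.ofReal_mul, Complex.ofReal_mul, Complex.ofReal_pow]
    push_cast
    field_simp
  rw [← hfin, hdiff]
  ring
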